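/- Let $G$ be a finite simple graph with $n\ge 1$ nodes $v_1,\dots,v_n$. A \emph{tube} of $G$ is a nonempty proper subset of the nodes that induces a connected subgraph. Two tubes $u_1,u_2$ \emph{intersect} if $u_1\cap u_2\ne\emptyset$, $u_1\not\subseteq u_2$ and $u_2\not\subseteq u_1$; they are \emph{adjacent} if $u_1\cap u_2=\emptyset$ and $u_1\cup u_2$ induces a connected subgraph of $G$; they are \emph{compatible} if they neither intersect nor are adjacent. A \emph{tubing} of $G$ is a (possibly empty) set of pairwise compatible tubes which, if $G$ is disconnected, does not contain all the node sets of the connected components of $G$. Let $M_G$ be the set of tubings of $G$ with exactly $n-1$ tubes. For $U\in M_G$ and a node $v$, let $t(v)$ be the smallest tube of $U$ containing $v$, or the set of all nodes of $G$ if no tube of $U$ contains $v$. Then for each $U\in M_G$ there is exactly one function $f_U$ from the nodes of $G$ to $\mathbb R$ such that $f_U(v)=0$ whenever $\{v\}\in U$, and $$\sum_{x\in t(v)} f_U(x)=3^{|t(v)|-2}$$ for every node $v$ with $\{v\}\notin U$; and $f_U$ is integer valued if $n\ge 2$. Put $c(U)=(f_U(v_1),\dots,f_U(v_n))\in\mathbb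 R^n$. The convex hull of the points $c(U)$, $U\in M_G$, is a realization of the graph-associahedron $\mathcal PG$: it is a simple convex polytope (each vertex lies in exactly as many facets as the dimension of the polytope), and its poset of nonempty faces, ordered by inclusion, is isomorphic to the set of tubings of $G$ ordered so that $U\preceq U'$ if and only if $U\supseteq U'$. -/

import Mathlib

namespace GraphAssociahedron

section Tubings

variable {V : Type*} [Fintype V]

/-- A tube of `G`: a proper (nonempty) set of nodes whose induced subgraph is connected.
(`SimpleGraph.Connected` includes nonemptiness.) -/
def IsTube (G : SimpleGraph V) (u : Finset V) : Prop :=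
  u ≠ Finset.univ ∧ (G.induce (u : Set V)).Connected

/-- Two tubes intersect if they share a node and neither contains the other. -/
def Intersect (u₁ u₂ : Finset V) : Prop :=
  ¬ Disjoint u₁ u₂ ∧ ¬ u₁ ⊆ u₂ ∧ ¬ u₂ ⊆ u₁

/-- Two tubes are adjacent if they are disjoint and their union induces a connected subgraph
(the union may be the whole node set). -/
def Adjacent (G : SimpleGraph V) (u₁ u₂ : Finset V) : Prop :=
  Disjoint u₁ u₂ ∧ (G.induce ((u₁ : Set V) ∪ (u₂ : Set V))).Connected

def Compatible (G : SimpleGraph V) (u₁ u₂ : Finset V) : Prop :=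
  ¬ Intersect u₁ u₂ ∧ ¬ Adjacent G u₁ u₂

/-- A tubing: a set of pairwise compatible tubes which, if `G` is disconnected, does not contain
all the connected components of `G`. -/
structure IsTubing (G : SimpleGraph V) (U : Finset (Finset V)) : Prop where
  isTube : ∀ u ∈ U, IsTube G u
  compatible : ∀ u₁ ∈ U, ∀ u₂ ∈ U, u₁ ≠ u₂ → Compatible G u₁ u₂
  not_all_components : ¬ G.Connected →
    ¬ ∀ C : G.ConnectedComponent, ∃ u ∈ U, (u : Set V) = C.supp

/-- The tubings of `G`, ordered by inclusion of sets of tubes. -/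
abbrev Tubing (G : SimpleGraph V) : Type _ := {U : Finset (Finset V) // IsTubing G U}

/-- The set `M_G` of the tubings of `G` with `n - 1` tubes, `n` being the number of nodes. -/
abbrev MaxTubing (G : SimpleGraph V) : Type _ :=
  {U : Finset (Finset V) // IsTubing G U ∧ U.card + 1 = Fintype.card V}

/-- `t` is the smallest tube of `U` containing the node `v`; it is the whole node set if no tube
of `U` contains `v`. -/
def IsSmallestTube (U : Finset (Finset V)) (v : V) (t : Finset V) : Prop :=
  IsLeast {s : Finset V | (s ∈ U ∨ s = Finset.univ) ∧ v ∈ s} t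

/-- The conditions that determine the node values `f` of a tubing `U`: a node that is itself a
tube of `U` has value `0`; for every other node `v` the values on the smallest tube `t` containing
`v` sum to `3 ^ (|t| - 2)`. -/
def IsNodeValuation (U : Finset (Finset V)) (f : V → ℝ) : Prop :=
  ∀ v : V, ({v} ∈ U → f v = 0) ∧
    ({v} ∉ U → ∀ t : Finset V, IsSmallestTube U v t →
      ∑ x ∈ t, f x = (3 : ℝ) ^ ((t.card : ℤ) - 2))

end Tubings

section Polytopes

variable {E : Type*} [AddCommGroup E] [Module ℝ E] [TopologicalSpace E]

def IsConvexPolytope (P : Set E) : Prop :=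
  ∃ s : Set E, s.Finite ∧ P = convexHull ℝ s

/-- The nonempty faces of `P` (the intersections of `P` with supporting hyperplanes, and `P`
itself), ordered by inclusion. -/
abbrev Face (P : Set E) : Type _ := {F : Set E // F.Nonempty ∧ IsExposed ℝ P F}

/-- The dimension of the affine span. -/
noncomputable def dim (P : Set E) : ℕ := Module.finrank ℝ (vectorSpan ℝ P)

/-- A face of codimension one. -/
def IsFacet {P : Set E} (F : Face P) : Prop := dim F.1 + 1 = dim P

/-- A simple polytope: a nonempty convex polytope, each vertex of which lies in exactly `dim P`
facets. -/
def IsSimplePolytope (P : Set E) : Prop :=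
  IsConvexPolytope P ∧ P.Nonempty ∧
    ∀ x : E, IsExposed ℝ P {x} → {F : Face P | IsFacet F ∧ x ∈ F.1}.encard = (dim P : ℕ∞)

end Polytopes

/-- `P` is (a realization of) the graph-associahedron of `G`: a simple convex polytope whose poset
of nonempty faces is isomorphic to the set of tubings of `G`, ordered by reverse inclusion. -/
def IsGraphAssociahedron {V : Type*} [Fintype V] (G : SimpleGraph V) {E : Type*} [AddCommGroup E]
    [Module ℝ E] [TopologicalSpace E] (P : Set E) : Prop :=
  IsSimplePolytope P ∧ Nonempty (Face P ≃o (Tubing G)ᵒᵈ)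

end GraphAssociahedron

namespace GraphAssociahedron

/-! ### Tubings, smallest tubes and extension to maximal tubings. -/

section Combinatorics

variable {V : Type*} {G : SimpleGraph V}

/-! The hull is the polytope `tubePolytope G`: the total is fixed at 3^(n-2), and each tube u has
sum at least 3^(|u|-2), or 0 if u is a single node. The engine is the strict superadditivity of
these weights (`sizeWeight_add_lt`). It makes the tubes tight at a point of the polytope a tubing
(`isTubing_tightTubes`): two incompatible tight tubes would leave too small a sum on their connected
union. It also shows that c(U) satisfies every inequality, with equality exactly for the tubes of U
(`IsTubing.tubeWeight_lt_sum`).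

In a maximal tubing U, v ↦ t(v) is a bijection onto U together with the whole node set, so the sums
over these sets are triangular linear coordinates on ℝ^V. Hence c(U) exists and is unique, and any
of its tight inequalities can be relaxed independently of the others. Every tubing extends to a
maximal one, so small moves in these coordinates show that the nonempty faces are the sets where the
tubes of a given tubing are tight, that such a face has dimension n-1-|U|, and that the extreme
points are the c(U). Simplicity is then a count of one-tube subsets. -/

theorem exists_adj_of_connected_induce {A B : Set V} (hA : (G.induce A).Connected) {a b : V}
    (ha : a ∈ A) (haB : a ∈ B) (hb : b ∈ A) (hbB : b ∉ B) :
    ∃ x ∈ A, ∃ y ∈ A, x ∈ B ∧ y ∉ B ∧ G.Adj x y := by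
  obtain ⟨p⟩ := hA.preconnected ⟨a, ha⟩ ⟨b, hb⟩
  obtain ⟨d, -, h1, h2⟩ := p.exists_boundary_dart {z | (z : V) ∈ B} haB hbB
  exact ⟨d.fst, d.fst.2, d.snd, d.snd.2, h1, h2, d.adj⟩

theorem nonempty_of_connected_induce {u : Finset V} (hu : (G.induce (u : Set V)).Connected) :
    u.Nonempty := by
  obtain ⟨x⟩ := hu.nonempty
  exact ⟨x, x.2⟩

/-- Connected sets are compatible if and only if their union is connected only when they are
nested. -/
theorem compatible_iff {u₁ u₂ : Finset V} (h₁ : (G.induce (u₁ : Set V)).Connected)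
    (h₂ : (G.induce (u₂ : Set V)).Connected) :
    Compatible G u₁ u₂ ↔
      ((G.induce ((u₁ : Set V) ∪ (u₂ : Set V))).Connected → u₁ ⊆ u₂ ∨ u₂ ⊆ u₁) := by
  constructor
  · rintro ⟨hi, ha⟩ hc
    by_contra! h
    by_cases hd : Disjoint u₁ u₂
    · exact ha ⟨hd, hc⟩
    · exact hi ⟨hd, h.1, h.2⟩
  · intro h
    refine ⟨fun ⟨hd, hs₁, hs₂⟩ => ?_, fun ⟨hd, hc⟩ => ?_⟩
    · obtain ⟨x, hx₁, hx₂⟩ := Finset.not_disjoint_iff.mp hd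
      rcases h (SimpleGraph.induce_union_connected h₁.preconnected h₂.preconnected
        ⟨x, hx₁, hx₂⟩) with h | h
      · exact hs₁ h
      · exact hs₂ h
    · obtain ⟨x, hx⟩ := nonempty_of_connected_induce h₁
      obtain ⟨y, hy⟩ := nonempty_of_connected_induce h₂
      rcases h hc with h | h
      · exact Finset.disjoint_left.mp hd hx (h hx)
      · exact Finset.disjoint_left.mp hd (h hy) hy

theorem Compatible.symm {u₁ u₂ : Finset V} (h : Compatible G u₁ u₂) : Compatible G u₂ u₁ := by
  refine ⟨fun ⟨a, b, c⟩ => h.1 ⟨fun d => a d.symm, c, b⟩, fun ⟨a, b⟩ => h.2 ⟨a.symm, ?_⟩⟩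
  rwa [Set.union_comm]

/-- A connected set covered by pairwise compatible connected sets lies in one of them. -/
theorem exists_superset_of_subset_iUnion {N : Finset (Finset V)}
    (hconn : ∀ m ∈ N, (G.induce (m : Set V)).Connected)
    (hcomp : ∀ m ∈ N, ∀ m' ∈ N, m ≠ m' → Compatible G m m') {A : Set V}
    (hA : (G.induce A).Connected) (hcov : ∀ x ∈ A, ∃ m ∈ N, x ∈ m) :
    ∃ m ∈ N, A ⊆ m := by
  classical
  obtain ⟨x₀, hx₀⟩ := hA.nonempty
  obtain ⟨m₀, hm₀, hxm₀⟩ := hcov x₀ hx₀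
  obtain ⟨m, hm, hmax⟩ := Finset.exists_max_image (N.filter (x₀ ∈ ·)) Finset.card
    ⟨m₀, Finset.mem_filter.mpr ⟨hm₀, hxm₀⟩⟩
  rw [Finset.mem_filter] at hm
  refine ⟨m, hm.1, fun b hb => ?_⟩
  -- An edge of `A` leaving `m` ends in some `m'`. Then `m ∪ m'` is connected, so compatibility
  -- nests the two sets, against the maximality of `m`.
  by_contra hbm
  obtain ⟨x, hx, y, hy, hxm, hym, hxy⟩ :=
    exists_adj_of_connected_induce hA hx₀ (B := m) hm.2 hb hbm
  obtain ⟨m', hm', hym'⟩ := hcov y hy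
  have hne : m ≠ m' := by rintro rfl; exact hym hym'
  have hc := SimpleGraph.connected_induce_union (hconn m hm.1).preconnected
    (hconn m' hm').preconnected hxm hym' hxy
  rcases (compatible_iff (hconn m hm.1) (hconn m' hm')).mp (hcomp m hm.1 m' hm' hne) hc with h | h
  · have := hmax m' (Finset.mem_filter.mpr ⟨hm', h hm.2⟩)
    exact hne (Finset.eq_of_subset_of_card_le h this)
  · exact hym (h hym')

variable [Fintype V]

namespace IsTubing

variable {U U' : Finset (Finset V)}

theorem connected (hU : IsTubing G U) {u : Finset V} (hu : u ∈ U) :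
    (G.induce (u : Set V)).Connected := (hU.isTube u hu).2

theorem univ_notMem (hU : IsTubing G U) : Finset.univ ∉ U := fun h => (hU.isTube _ h).1 rfl

theorem mono (hU : IsTubing G U) (h : U' ⊆ U) : IsTubing G U' where
  isTube u hu := hU.isTube u (h hu)
  compatible u hu v hv := hU.compatible u (h hu) v (h hv)
  not_all_components hG hall := hU.not_all_components hG fun C =>
    (hall C).imp fun _ hu => ⟨h hu.1, hu.2⟩

theorem subset_or_subset (hU : IsTubing G U) {s t : Finset V} (hs : s ∈ U ∨ s = Finset.univ)
    (ht : t ∈ U ∨ t = Finset.univ) {x : V} (hxs : x ∈ s) (hxt : x ∈ t) : s ⊆ t ∨ t ⊆ s := by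
  rcases hs with hs | rfl
  · rcases ht with ht | rfl
    · by_cases hne : s = t
      · exact .inl hne.subset
      · refine (compatible_iff (hU.connected hs) (hU.connected ht)).mp
          (hU.compatible s hs t ht hne) ?_
        exact SimpleGraph.induce_union_connected (hU.connected hs).preconnected
          (hU.connected ht).preconnected ⟨x, hxs, hxt⟩
    · exact .inl (Finset.subset_univ s)
  · exact .inr (Finset.subset_univ t)

theorem exists_isSmallestTube (hU : IsTubing G U) (v : V) : ∃ t, IsSmallestTube U v t := by
  classical
  obtain ⟨t, ht, hmin⟩ := Finset.exists_min_image ((insert Finset.univ U).filter (v ∈ ·))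
    Finset.card ⟨Finset.univ, by simp⟩
  simp only [Finset.mem_filter, Finset.mem_insert] at ht hmin
  refine ⟨t, ⟨ht.1.symm, ht.2⟩, fun s hs => ?_⟩
  rcases hU.subset_or_subset ht.1.symm hs.1 ht.2 hs.2 with h | h
  · exact h
  · exact (Finset.eq_of_subset_of_card_le h (hmin s ⟨hs.1.symm, hs.2⟩)).ge

/-- Otherwise smaller tubes cover `s`. A connected `s` would then lie in one of them. If `s` is
everything and `G` is disconnected, each component lies in a tube and so equals it, which the last
tubing axiom forbids. -/
theorem exists_node [Nonempty V] (hU : IsTubing G U) {s : Finset V}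
    (hs : s ∈ U ∨ s = Finset.univ) : ∃ v, IsSmallestTube U v s := by
  by_contra! h
  have hcov : ∀ x ∈ s, ∃ m ∈ U, m ⊂ s ∧ x ∈ m := by
    intro x hx
    obtain ⟨t, ht⟩ := hU.exists_isSmallestTube x
    have hts : t ≠ s := by rintro rfl; exact h x ht
    have hsub : t ⊂ s := lt_of_le_of_ne (ht.2 ⟨hs, hx⟩) hts
    rcases ht.1.1 with htU | rfl
    · exact ⟨t, htU, hsub, ht.1.2⟩
    · exact absurd (Finset.subset_univ s) hsub.2
  have hno : ¬ (G.induce (s : Set V)).Connected := by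
    intro hc
    classical
    obtain ⟨m, hm, hsm⟩ := exists_superset_of_subset_iUnion (N := U.filter (· ⊂ s)) (A := s)
      (fun m hm => hU.connected (Finset.mem_filter.mp hm).1)
      (fun m hm m' hm' => hU.compatible m (Finset.mem_filter.mp hm).1 m'
        (Finset.mem_filter.mp hm').1) hc
      (fun x hx => by
        obtain ⟨m, h1, h2, h3⟩ := hcov x hx
        exact ⟨m, Finset.mem_filter.mpr ⟨h1, h2⟩, h3⟩)
    exact (Finset.mem_filter.mp hm).2.2 (by exact_mod_cast hsm)
  rcases hs with hs | rfl
  · exact hno (hU.connected hs)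
  · have hG : ¬ G.Connected := fun hG => hno (by
      rw [Finset.coe_univ]
      exact (SimpleGraph.induceUnivIso G).connected_iff.mpr hG)
    refine hU.not_all_components hG fun C => ?_
    have hC := C.maximal_connected_induce_supp
    obtain ⟨m, hm, hCm⟩ := exists_superset_of_subset_iUnion (N := U) (fun m hm => hU.connected hm)
      hU.compatible hC.1 (fun x _ => by
        obtain ⟨m, h1, -, h3⟩ := hcov x (Finset.mem_univ x)
        exact ⟨m, h1, h3⟩)
    exact ⟨m, hm, (hC.2 (hU.connected hm) hCm).antisymm hCm⟩

end IsTubing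

theorem isTubing_empty [Nonempty V] : IsTubing G ∅ where
  isTube := by simp
  compatible := by simp
  not_all_components _ h := by
    obtain ⟨v⟩ := ‹Nonempty V›
    obtain ⟨u, hu, -⟩ := h (G.connectedComponentMk v)
    simp at hu

theorem IsSmallestTube.unique {U : Finset (Finset V)} {v : V} {s t : Finset V}
    (hs : IsSmallestTube U v s) (ht : IsSmallestTube U v t) : s = t :=
  IsLeast.unique hs ht

/-- Two nodes with the same smallest tube `s` allow a further tube: the component of `s \ {v}`
containing the other node. -/
theorem IsTubing.exists_insert {U : Finset (Finset V)} (hU : IsTubing G U) {v v' : V}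
    (hne : v ≠ v') {s : Finset V} (hv : IsSmallestTube U v s) (hv' : IsSmallestTube U v' s) :
    ∃ U', U ⊂ U' ∧ IsTubing G U' := by
  classical
  let S : Finset (Finset V) := Finset.univ.filter fun A =>
    (G.induce (A : Set V)).Connected ∧ A ⊆ s ∧ v ∉ A ∧ v' ∈ A
  have hmemS : ∀ A, A ∈ S ↔ (G.induce (A : Set V)).Connected ∧ A ⊆ s ∧ v ∉ A ∧ v' ∈ A := by
    intro A; simp [S]
  have hS : S.Nonempty := by
    refine ⟨{v'}, (hmemS _).mpr ⟨?_, by simpa using hv'.1.2, by simpa using hne, by simp⟩⟩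
    rw [Finset.coe_singleton]
    exact SimpleGraph.Connected.mk (Subsingleton.elim · · ▸ SimpleGraph.Reachable.refl _)
  obtain ⟨c, hc, hmax⟩ := Finset.exists_max_image S Finset.card hS
  obtain ⟨hcc, hcs, hvc, hvc'⟩ := (hmemS c).mp hc
  have habsorb : ∀ m : Finset V, m ⊆ s → v ∉ m →
      (G.induce ((c : Set V) ∪ (m : Set V))).Connected → m ⊆ c := by
    intro m hms hvm hcm
    have hmem : c ∪ m ∈ S := (hmemS _).mpr ⟨by rwa [Finset.coe_union],
      Finset.union_subset hcs hms, by simp [hvc, hvm], by simp [hvc']⟩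
    have := Finset.eq_of_subset_of_card_le Finset.subset_union_left (hmax _ hmem)
    rw [this]; exact Finset.subset_union_right
  have hcU : c ∉ U := fun h => hvc ((hv'.2 ⟨.inl h, hvc'⟩) hv.1.2)
  have hcomp : ∀ m ∈ U, Compatible G c m := by
    intro m hm
    refine (compatible_iff hcc (hU.connected hm)).mpr fun hcm => ?_
    by_cases hms : m ⊆ s
    · by_cases hvm : v ∈ m
      · exact .inl (hcs.trans (hv.2 ⟨.inl hm, hvm⟩))
      · exact .inr (habsorb m hms hvm hcm)
    · by_cases hsm : s ⊆ m
      · exact .inl (hcs.trans hsm)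
      -- Here `m` and `s` are not nested, yet `c ∪ m` connected and `c ⊆ s` make `s ∪ m` connected,
      -- so `s` and `m` would be incompatible.
      exfalso
      have hsU : s ∈ U := hv.1.1.resolve_right (by rintro rfl; exact hms (Finset.subset_univ _))
      have hu := SimpleGraph.induce_union_connected (hU.connected hsU).preconnected
        hcm.preconnected ⟨v', hv'.1.2, .inl hvc'⟩
      rw [← Set.union_assoc, Set.union_eq_self_of_subset_right (s := (s : Set V)) (t := c)
        (by exact_mod_cast hcs)] at hu
      rcases (compatible_iff (hU.connected hsU) (hU.connected hm)).mp
        (hU.compatible s hsU m hm (by rintro rfl; exact hms subset_rfl)) hu with h | h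
      · exact hsm h
      · exact hms h
  refine ⟨insert c U, Finset.ssubset_insert hcU, ?_, ?_, ?_⟩
  · intro u hu
    rcases Finset.mem_insert.mp hu with rfl | hu
    · exact ⟨by rintro rfl; exact hvc (Finset.mem_univ v), hcc⟩
    · exact hU.isTube u hu
  · intro u₁ h₁ u₂ h₂ h
    rcases Finset.mem_insert.mp h₁ with rfl | h₁U <;>
      rcases Finset.mem_insert.mp h₂ with rfl | h₂U
    · exact absurd rfl h
    · exact hcomp _ h₂U
    · exact (hcomp _ h₁U).symm
    · exact hU.compatible _ h₁U _ h₂U h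
  · intro hG hall
    refine hU.not_all_components hG fun C => ?_
    obtain ⟨u, hu, huC⟩ := hall C
    rcases Finset.mem_insert.mp hu with rfl | hu
    -- If `c` were a component, a tube `s ⊇ c` would equal it although `v ∈ s \ c`. If `s` is
    -- everything, no tube of `U` contains `v`, so the component of `v` is missing.
    · exfalso
      rcases hv.1.1 with hsU | rfl
      · have := C.maximal_connected_induce_supp.2 (hU.connected hsU)
          (huC ▸ by exact_mod_cast hcs)
        rw [← huC] at this
        exact hvc (this hv.1.2)
      · obtain ⟨w, hw, hwC⟩ := hall (G.connectedComponentMk v)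
        have hvw : v ∈ w := by
          rw [← Finset.mem_coe, hwC]; rfl
        rcases Finset.mem_insert.mp hw with rfl | hw
        · exact hvc hvw
        · exact hU.univ_notMem (Finset.univ_subset_iff.mp (hv.2 ⟨.inl hw, hvw⟩) ▸ hw)
    · exact ⟨u, hu, huC⟩

theorem IsTubing.image_eq_insert [Nonempty V] [DecidableEq V] {U : Finset (Finset V)}
    (hU : IsTubing G U) {t : V → Finset V} (ht : ∀ v, IsSmallestTube U v (t v)) :
    Finset.univ.image t = insert Finset.univ U := by
  ext s
  simp only [Finset.mem_image, Finset.mem_univ, true_and, Finset.mem_insert]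
  constructor
  · rintro ⟨v, rfl⟩
    exact (ht v).1.1.symm
  · intro hs
    obtain ⟨v, hv⟩ := hU.exists_node hs.symm
    exact ⟨v, (ht v).unique hv⟩

/-- By `exists_node`, `t` maps the n nodes onto the n sets of `U` and the whole node set. -/
theorem IsTubing.injective_of_card [Nonempty V] {U : Finset (Finset V)} (hU : IsTubing G U)
    (hcard : U.card + 1 = Fintype.card V) {t : V → Finset V}
    (ht : ∀ v, IsSmallestTube U v (t v)) : Function.Injective t := by
  classical
  rw [← Set.injOn_univ, ← Finset.coe_univ, ← Finset.card_image_iff, hU.image_eq_insert ht,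
    Finset.card_insert_of_notMem hU.univ_notMem, hcard, Finset.card_univ]

/-- Every tubing extends to one with `n - 1` tubes. -/
theorem IsTubing.exists_maxTubing [Nonempty V] {U : Finset (Finset V)} (hU : IsTubing G U) :
    ∃ U', U ⊆ U' ∧ IsTubing G U' ∧ U'.card + 1 = Fintype.card V := by
  classical
  obtain ⟨W, hW, hmax⟩ := Finset.exists_max_image
    (Finset.univ.filter fun W => U ⊆ W ∧ IsTubing G W) Finset.card ⟨U, by simp [hU]⟩
  simp only [Finset.mem_filter, Finset.mem_univ, true_and] at hW hmax
  refine ⟨W, hW.1, hW.2, ?_⟩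
  choose t ht using hW.2.exists_isSmallestTube
  have hinj : Function.Injective t := by
    intro v v' h
    by_contra hne
    obtain ⟨W', hWW', hW'⟩ := hW.2.exists_insert hne (ht v) (h ▸ ht v')
    exact absurd (hmax W' ⟨hW.1.trans hWW'.1, hW'⟩) (not_le.mpr (Finset.card_lt_card hWW'))
  rw [← Finset.card_insert_of_notMem hW.2.univ_notMem, ← hW.2.image_eq_insert ht,
    Finset.card_image_of_injective _ hinj, Finset.card_univ]

end Combinatorics

/-! ### Superadditive weights and the points c(U). -/

section Valuations

/-- The value `3 ^ (k - 2)` prescribed for a tube with `k ≥ 2` nodes, and `0` for `k ≤ 1`. -/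
noncomputable def sizeWeight (k : ℕ) : ℝ := if k ≤ 1 then 0 else 3 ^ (k - 2)

theorem sizeWeight_nonneg (k : ℕ) : 0 ≤ sizeWeight k := by
  unfold sizeWeight; split_ifs <;> positivity

/-- Each summand is at most a third of `sizeWeight k`. Base 2 would give only halves, with equality
possible, so 3 is the least integer base that works. -/
theorem sizeWeight_add_lt {a b k : ℕ} (ha : a < k) (hb : b < k) (hk : 2 ≤ k) :
    sizeWeight a + sizeWeight b < sizeWeight k := by
  obtain ⟨k, rfl⟩ := Nat.exists_eq_add_of_le' hk
  have key : ∀ a, a < k + 2 → 3 * sizeWeight a ≤ 3 ^ k := by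
    intro a ha
    unfold sizeWeight
    split_ifs with h
    · simp
    · rw [← pow_succ']
      exact pow_le_pow_right₀ (by norm_num) (by omega)
  have h1 := key a ha
  have h2 := key b hb
  have h3 : sizeWeight (k + 2) = 3 ^ k := by simp [sizeWeight]
  have h4 : (0 : ℝ) < 3 ^ k := by positivity
  rw [h3]
  linarith

theorem sizeWeight_add_le (a b : ℕ) : sizeWeight a + sizeWeight b ≤ sizeWeight (a + b) := by
  have h0 : sizeWeight 0 = 0 := by simp [sizeWeight]
  rcases Nat.eq_zero_or_pos a with rfl | ha
  · simp [h0]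
  rcases Nat.eq_zero_or_pos b with rfl | hb
  · simp [h0]
  exact (sizeWeight_add_lt (by omega) (by omega) (by omega)).le

variable {V : Type*}

/-- If the members of a laminar family attain their size weights, then the sum over any union of
members is at most the size weight of that union. -/
theorem sum_le_sizeWeight_of_cover {U : Finset (Finset V)} {f : V → ℝ}
    (hlam : ∀ s ∈ U, ∀ t ∈ U, ∀ x ∈ s, x ∈ t → s ⊆ t ∨ t ⊆ s)
    (hf : ∀ s ∈ U, ∑ x ∈ s, f x = sizeWeight s.card) (A : Finset V)
    (hA : ∀ x ∈ A, ∃ s ∈ U, x ∈ s ∧ s ⊆ A) : ∑ x ∈ A, f x ≤ sizeWeight A.card := by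
  classical
  induction A using Finset.strongInduction with
  | H A ih =>
    rcases A.eq_empty_or_nonempty with rfl | ⟨x₀, hx₀⟩
    · simp [sizeWeight]
    obtain ⟨s₀, hs₀, hxs₀, hsA₀⟩ := hA x₀ hx₀
    -- Remove a largest member inside `A` through `x₀`; laminarity keeps `A \ s` a union of members.
    obtain ⟨s, hs, hmax⟩ := Finset.exists_max_image (U.filter fun s => x₀ ∈ s ∧ s ⊆ A) Finset.card
      ⟨s₀, Finset.mem_filter.mpr ⟨hs₀, hxs₀, hsA₀⟩⟩
    obtain ⟨hsU, hxs, hsA⟩ := Finset.mem_filter.mp hs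
    have hrest := ih (A \ s) (Finset.sdiff_ssubset hsA ⟨x₀, hxs⟩) (fun y hy => by
      obtain ⟨hyA, hys⟩ := Finset.mem_sdiff.mp hy
      obtain ⟨r, hrU, hyr, hrA⟩ := hA y hyA
      refine ⟨r, hrU, hyr, Finset.subset_sdiff.mpr ⟨hrA, ?_⟩⟩
      rw [Finset.disjoint_left]
      intro z hzr hzs
      rcases hlam r hrU s hsU z hzr hzs with h | h
      · exact hys (h hyr)
      · have := Finset.eq_of_subset_of_card_le h
          (hmax r (Finset.mem_filter.mpr ⟨hrU, h hxs, hrA⟩))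
        exact hys (this ▸ hyr))
    have hadd := sizeWeight_add_le (A \ s).card s.card
    rw [Finset.card_sdiff_add_card_eq_card hsA] at hadd
    rw [← Finset.sum_sdiff hsA, hf s hsU]
    linarith

/-- By injectivity `t x` is strictly smaller than `t v` for every other `x ∈ t v`, so the system of
sums over the `t v` is triangular. -/
theorem node_induction {t : V → Finset V} (hsub : ∀ v, ∀ x ∈ t v, t x ⊆ t v)
    (hinj : Function.Injective t) {p : V → Prop}
    (h : ∀ v, (∀ x ∈ t v, x ≠ v → p x) → p v) (v : V) : p v := by
  induction hn : (t v).card using Nat.strong_induction_on generalizing v with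
  | _ n ih =>
    subst hn
    refine h v fun x hx hxv => ih _ (Finset.card_lt_card ?_) x rfl
    exact lt_of_le_of_ne (hsub v x hx) fun he => hxv (hinj he)

theorem exists_int_of_sum {t : V → Finset V} (hmem : ∀ v, v ∈ t v)
    (hsub : ∀ v, ∀ x ∈ t v, t x ⊆ t v) (hinj : Function.Injective t) {f : V → ℝ}
    (hf : ∀ v, ∃ m : ℤ, ∑ x ∈ t v, f x = m) (v : V) :
    ∃ m : ℤ, f v = m := by
  classical
  refine node_induction hsub hinj (p := fun v => ∃ m : ℤ, f v = m) (fun v ih => ?_) v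
  choose! k hk using ih
  obtain ⟨m, hm⟩ := hf v
  refine ⟨m - ∑ x ∈ (t v).erase v, k x, ?_⟩
  rw [← Finset.sum_erase_add _ _ (hmem v), Finset.sum_congr rfl fun x hx =>
    hk x (Finset.mem_of_mem_erase hx) (Finset.ne_of_mem_erase hx)] at hm
  push_cast
  linarith

variable [Fintype V]

open Classical in
/-- The value prescribed for the sum over `s`. -/
noncomputable def tubeWeight (s : Finset V) : ℝ :=
  -- With a single node the prescribed total is 3⁻¹, whereas `sizeWeight 1 = 0`. For two or more
  -- nodes both branches agree on the whole set.
  if s = Finset.univ then (3 : ℝ) ^ ((s.card : ℤ) - 2) else sizeWeight s.card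

theorem tubeWeight_of_ne_univ {s : Finset V} (hs : s ≠ Finset.univ) :
    tubeWeight s = sizeWeight s.card := if_neg hs

theorem tubeWeight_of_one_lt {s : Finset V} (hs : 1 < s.card) :
    tubeWeight s = (3 : ℝ) ^ ((s.card : ℤ) - 2) := by
  unfold tubeWeight sizeWeight
  split_ifs with h h'
  · rfl
  · omega
  · rw [← zpow_natCast, Nat.cast_sub (by omega)]
    rfl

theorem sizeWeight_le_tubeWeight (s : Finset V) : sizeWeight s.card ≤ tubeWeight s := by
  by_cases h : s = Finset.univ
  · by_cases h1 : 1 < s.card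
    · rw [tubeWeight_of_one_lt h1, sizeWeight, if_neg (by omega), ← zpow_natCast,
        Nat.cast_sub (by omega)]
      rfl
    · rw [sizeWeight, if_pos (by omega), tubeWeight, if_pos h]
      positivity
  · exact (tubeWeight_of_ne_univ h).ge

theorem exists_int_tubeWeight (hV : 2 ≤ Fintype.card V) (s : Finset V) :
    ∃ m : ℤ, tubeWeight s = m := by
  have key : ∀ k, ∃ m : ℤ, sizeWeight k = m := by
    intro k
    unfold sizeWeight
    split_ifs
    · exact ⟨0, by simp⟩
    · exact ⟨3 ^ (k - 2), by simp⟩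
  by_cases h : s = Finset.univ
  · obtain ⟨m, hm⟩ := key s.card
    have h1 : 1 < s.card := by rw [h, Finset.card_univ]; omega
    refine ⟨m, ?_⟩
    rw [← hm, tubeWeight_of_one_lt h1, sizeWeight, if_neg (by omega), ← zpow_natCast,
        Nat.cast_sub (by omega)]
    rfl
  · rw [tubeWeight_of_ne_univ h]
    exact key _

theorem existsUnique_sum_eq {t : V → Finset V} (hmem : ∀ v, v ∈ t v)
    (hsub : ∀ v, ∀ x ∈ t v, t x ⊆ t v) (hinj : Function.Injective t) (b : V → ℝ) :
    ∃! f : V → ℝ, ∀ v, ∑ x ∈ t v, f x = b v := by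
  classical
  let L : (V → ℝ) →ₗ[ℝ] (V → ℝ) := LinearMap.pi fun v => ∑ x ∈ t v, LinearMap.proj x
  have hL : ∀ f v, L f v = ∑ x ∈ t v, f x := fun f v => by simp [L]
  have hLinj : Function.Injective L := by
    rw [← LinearMap.ker_eq_bot, LinearMap.ker_eq_bot']
    intro d hd
    ext v
    refine node_induction hsub hinj (p := fun v => d v = 0) (fun v ih => ?_) v
    have := congrFun hd v
    rwa [hL, Finset.sum_eq_single_of_mem v (hmem v) ih] at this
  obtain ⟨f, hf⟩ := LinearMap.injective_iff_surjective.mp hLinj b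
  refine ⟨f, fun v => by rw [← hL, hf], fun g hg => hLinj ?_⟩
  rw [hf]
  ext v
  rw [hL, hg]

theorem IsSmallestTube.subset {U : Finset (Finset V)} {v x : V} {s r : Finset V}
    (hs : IsSmallestTube U v s) (hr : IsSmallestTube U x r) (hx : x ∈ s) : r ⊆ s :=
  hr.2 ⟨hs.1.1, hx⟩

variable {G : SimpleGraph V}

/-- Every set of `U`, and the whole node set, is the smallest tube of some node, so conditions
indexed by nodes become conditions indexed by tubes. Singleton tubes fit because their weight is 0.
-/
theorem IsTubing.isNodeValuation_iff [Nonempty V] {U : Finset (Finset V)} (hU : IsTubing G U)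
    (f : V → ℝ) :
    IsNodeValuation U f ↔ ∀ s, s ∈ U ∨ s = Finset.univ → ∑ x ∈ s, f x = tubeWeight s := by
  have hsing : ∀ v : V, {v} ∈ U → tubeWeight ({v} : Finset V) = 0 := fun v hv => by
    rw [tubeWeight_of_ne_univ (hU.isTube _ hv).1]
    simp [sizeWeight]
  have hbig : ∀ (v : V) (s : Finset V), {v} ∉ U → IsSmallestTube U v s →
      tubeWeight s = (3 : ℝ) ^ ((s.card : ℤ) - 2) := fun v s hv hs => by
    by_cases h : s = Finset.univ
    · exact if_pos h
    · refine tubeWeight_of_one_lt ?_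
      by_contra hc
      have h1 : s = {v} := (Finset.eq_singleton_iff_unique_mem).mpr
        ⟨hs.1.2, fun x hx => Finset.card_le_one.mp (by omega) x hx v hs.1.2⟩
      exact hv (h1 ▸ hs.1.1.resolve_right h)
  constructor
  · intro h s hs
    obtain ⟨v, hv⟩ := hU.exists_node hs
    by_cases hvU : {v} ∈ U
    · have : s = {v} := hv.unique ⟨⟨.inl hvU, by simp⟩, fun r hr => by simpa using hr.2⟩
      rw [this, hsing v hvU, Finset.sum_singleton, (h v).1 hvU]
    · rw [(h v).2 hvU s hv, hbig v s hvU hv]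
  · intro h v
    refine ⟨fun hv => ?_, fun hv s hs => ?_⟩
    · simpa [hsing v hv] using h {v} (.inl hv)
    · rw [h s hs.1.1, hbig v s hv hs]

theorem IsTubing.existsUnique_sum_eq [Nonempty V] {U : Finset (Finset V)} (hU : IsTubing G U)
    (hcard : U.card + 1 = Fintype.card V) (b : Finset V → ℝ) :
    ∃! f : V → ℝ, ∀ s, s ∈ U ∨ s = Finset.univ → ∑ x ∈ s, f x = b s := by
  choose t ht using hU.exists_isSmallestTube
  have hiff : ∀ f : V → ℝ, (∀ s, s ∈ U ∨ s = Finset.univ → ∑ x ∈ s, f x = b s) ↔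
      ∀ v, ∑ x ∈ t v, f x = b (t v) := by
    refine fun f => ⟨fun h v => h _ (ht v).1.1, fun h s hs => ?_⟩
    obtain ⟨v, hv⟩ := hU.exists_node hs
    rw [hv.unique (ht v), h]
  simp only [hiff]
  exact GraphAssociahedron.existsUnique_sum_eq (fun v => (ht v).1.2)
    (fun v x hx => (ht v).subset (ht x) hx) (hU.injective_of_card hcard ht) fun v => b (t v)

theorem IsTubing.exists_int_of_sum [Nonempty V] {U : Finset (Finset V)} (hU : IsTubing G U)
    (hcard : U.card + 1 = Fintype.card V) (hV : 2 ≤ Fintype.card V) {f : V → ℝ}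
    (hf : ∀ s, s ∈ U ∨ s = Finset.univ → ∑ x ∈ s, f x = tubeWeight s) (v : V) :
    ∃ m : ℤ, f v = m := by
  choose t ht using hU.exists_isSmallestTube
  exact GraphAssociahedron.exists_int_of_sum (fun v => (ht v).1.2)
    (fun v x hx => (ht v).subset (ht x) hx) (hU.injective_of_card hcard ht)
    (fun v => hf _ (ht v).1.1 ▸ exists_int_tubeWeight hV _) v

variable (G) in
/-- The solution set of the inequalities given by the tubes. -/
def tubePolytope : Set (V → ℝ) :=
  {x | ∑ v, x v = tubeWeight (Finset.univ : Finset V) ∧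
    ∀ u, IsTube G u → tubeWeight u ≤ ∑ v ∈ u, x v}

open Classical in
variable (G) in
/-- The tubes whose inequality is attained at `x`. -/
noncomputable def tightTubes (x : V → ℝ) : Finset (Finset V) :=
  Finset.univ.filter fun u => IsTube G u ∧ ∑ v ∈ u, x v = tubeWeight u

theorem mem_tightTubes {x : V → ℝ} {u : Finset V} :
    u ∈ tightTubes G x ↔ IsTube G u ∧ ∑ v ∈ u, x v = tubeWeight u := by
  simp [tightTubes]

/-! ### Tight inequalities at c(U). -/

section MaxTubing

variable [Nonempty V] {U : Finset (Finset V)} {f : V → ℝ}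

/-- Without `v`, the set `s` is a union of smaller tubes, so its sum is at most the weight of its
size; `v` must supply the rest. -/
theorem IsTubing.le_apply (hU : IsTubing G U) (hcard : U.card + 1 = Fintype.card V)
    (hf : ∀ s, s ∈ U ∨ s = Finset.univ → ∑ x ∈ s, f x = tubeWeight s) {v : V} {s : Finset V}
    (hs : IsSmallestTube U v s) :
    sizeWeight s.card - sizeWeight (s.card - 1) ≤ f v := by
  classical
  choose t ht using hU.exists_isSmallestTube
  have hinj := hU.injective_of_card hcard ht
  obtain rfl := hs.unique (ht v)
  have hrest : ∑ x ∈ (t v).erase v, f x ≤ sizeWeight ((t v).erase v).card := by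
    refine sum_le_sizeWeight_of_cover (U := U)
      (fun s hs r hr x hxs hxr => hU.subset_or_subset (.inl hs) (.inl hr) hxs hxr)
      (fun s hs => by rw [hf s (.inl hs), tubeWeight_of_ne_univ (hU.isTube s hs).1]) _
      fun x hx => ?_
    obtain ⟨hxv, hx⟩ := Finset.mem_erase.mp hx
    have hsub := (ht v).subset (ht x) hx
    have hvx : v ∉ t x := fun h => hxv (hinj (hsub.antisymm ((ht x).subset (ht v) h)))
    refine ⟨t x, (ht x).1.1.resolve_right fun h => hvx (h ▸ Finset.mem_univ v), (ht x).1.2, ?_⟩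
    exact Finset.subset_erase.mpr ⟨hsub, hvx⟩
  rw [Finset.card_erase_of_mem hs.1.2] at hrest
  have hsum := hf _ hs.1.1
  rw [← Finset.sum_erase_add _ _ hs.1.2] at hsum
  have := sizeWeight_le_tubeWeight (t v)
  linarith

theorem IsTubing.apply_nonneg (hU : IsTubing G U) (hcard : U.card + 1 = Fintype.card V)
    (hf : ∀ s, s ∈ U ∨ s = Finset.univ → ∑ x ∈ s, f x = tubeWeight s) (v : V) : 0 ≤ f v := by
  obtain ⟨s, hs⟩ := hU.exists_isSmallestTube v
  have h1 := hU.le_apply hcard hf hs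
  have h2 := sizeWeight_add_le (s.card - 1) 1
  rw [Nat.sub_add_cancel (Finset.card_pos.mpr ⟨v, hs.1.2⟩)] at h2
  have := sizeWeight_nonneg 1
  linarith

theorem IsTubing.tubeWeight_lt_sum (hU : IsTubing G U) (hcard : U.card + 1 = Fintype.card V)
    (hf : ∀ s, s ∈ U ∨ s = Finset.univ → ∑ x ∈ s, f x = tubeWeight s) {u : Finset V}
    (hu : IsTube G u) (huU : u ∉ U) : tubeWeight u < ∑ x ∈ u, f x := by
  classical
  obtain ⟨s, hs, hmin⟩ := Finset.exists_min_image ((insert Finset.univ U).filter (u ⊆ ·))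
    Finset.card ⟨Finset.univ, by simp⟩
  simp only [Finset.mem_filter, Finset.mem_insert] at hs hmin
  -- If no node of `u` had smallest tube `s`, tubes strictly inside `s` would cover the connected
  -- set `u`, and one would contain it, against the choice of `s`. The value at this `v` alone
  -- exceeds the weight of `u`.
  obtain ⟨v, hvu, hv⟩ : ∃ v ∈ u, IsSmallestTube U v s := by
    by_contra! h
    obtain ⟨m, hm, hum⟩ := exists_superset_of_subset_iUnion (N := U.filter (· ⊂ s)) (A := u)
      (fun m hm => hU.connected (Finset.mem_filter.mp hm).1)
      (fun m hm m' hm' => hU.compatible m (Finset.mem_filter.mp hm).1 m'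
        (Finset.mem_filter.mp hm').1) hu.2
      (fun x hx => by
        obtain ⟨r, hr⟩ := hU.exists_isSmallestTube x
        have hrs : r ⊂ s := lt_of_le_of_ne (hr.2 ⟨hs.1.symm, hs.2 hx⟩)
          (by rintro rfl; exact h x hx hr)
        refine ⟨r, Finset.mem_filter.mpr ⟨hr.1.1.resolve_right ?_, hrs⟩, hr.1.2⟩
        rintro rfl
        exact hrs.2 (Finset.subset_univ s))
    obtain ⟨hmU, hms⟩ := Finset.mem_filter.mp hm
    exact absurd (hmin m ⟨.inr hmU, by exact_mod_cast hum⟩) (not_le.mpr (Finset.card_lt_card hms))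
  have hus : u ⊂ s := lt_of_le_of_ne hs.2 (by
    rintro rfl
    exact hs.1.elim hu.1 huU)
  have hcard_lt := Finset.card_lt_card hus
  have hpos := Finset.card_pos.mpr ⟨v, hvu⟩
  have h1 := hU.le_apply hcard hf hv
  have h2 := sizeWeight_add_lt (a := s.card - 1) (b := u.card) (k := s.card)
    (by omega) hcard_lt (by omega)
  have h3 := Finset.single_le_sum (fun x _ => hU.apply_nonneg hcard hf x) hvu
  rw [tubeWeight_of_ne_univ hu.1]
  linarith

theorem IsTubing.mem_tubePolytope (hU : IsTubing G U) (hcard : U.card + 1 = Fintype.card V)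
    (hf : ∀ s, s ∈ U ∨ s = Finset.univ → ∑ x ∈ s, f x = tubeWeight s) : f ∈ tubePolytope G := by
  refine ⟨hf _ (.inr rfl), fun u hu => ?_⟩
  by_cases huU : u ∈ U
  · exact (hf u (.inl huU)).ge
  · exact (hU.tubeWeight_lt_sum hcard hf hu huU).le

theorem IsTubing.tightTubes_eq (hU : IsTubing G U) (hcard : U.card + 1 = Fintype.card V)
    (hf : ∀ s, s ∈ U ∨ s = Finset.univ → ∑ x ∈ s, f x = tubeWeight s) : tightTubes G f = U := by
  ext u
  rw [mem_tightTubes]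
  refine ⟨fun ⟨hu, h⟩ => ?_, fun h => ⟨hU.isTube u h, hf u (.inl h)⟩⟩
  by_contra huU
  exact (hU.tubeWeight_lt_sum hcard hf hu huU).ne' h

end MaxTubing

end Valuations

/-! ### The inequality description, its faces and its vertices. -/

section Realization

open Filter Topology

variable {V : Type*}

theorem sum_add_smul (x d : V → ℝ) (ε : ℝ) (u : Finset V) :
    ∑ v ∈ u, (x + ε • d) v = ∑ v ∈ u, x v + ε * ∑ v ∈ u, d v := by
  simp [Finset.sum_add_distrib, Finset.mul_sum]

variable [Fintype V] {G : SimpleGraph V}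

theorem nonneg_of_mem_tubePolytope {x : V → ℝ} (hx : x ∈ tubePolytope G) (v : V) : 0 ≤ x v := by
  by_cases h : ({v} : Finset V) = Finset.univ
  · have := hx.1
    rw [← h, Finset.sum_singleton] at this
    rw [this]
    exact (sizeWeight_nonneg _).trans (sizeWeight_le_tubeWeight _)
  · have hv : IsTube G {v} := by
      refine ⟨h, ?_⟩
      rw [Finset.coe_singleton]
      exact SimpleGraph.Connected.mk (Subsingleton.elim · · ▸ SimpleGraph.Reachable.refl _)
    have := hx.2 _ hv
    rw [Finset.sum_singleton] at this
    exact ((sizeWeight_nonneg _).trans (sizeWeight_le_tubeWeight _)).trans this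

theorem sum_eq_of_mem_tightTubes {x : V → ℝ} {u : Finset V} (hu : u ∈ tightTubes G x) :
    ∑ v ∈ u, x v = sizeWeight u.card := by
  obtain ⟨h1, h2⟩ := mem_tightTubes.mp hu
  rw [h2, tubeWeight_of_ne_univ h1.1]

/-- The tubes attained at a point of the polytope form a tubing, since the weights are strictly
superadditive. -/
theorem isTubing_tightTubes [Nonempty V] {x : V → ℝ} (hx : x ∈ tubePolytope G) :
    IsTubing G (tightTubes G x) := by
  classical
  have htube : ∀ u ∈ tightTubes G x, IsTube G u := fun u hu => (mem_tightTubes.mp hu).1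
  refine ⟨htube, ?_, ?_⟩
  · intro u₁ h₁ u₂ h₂ _
    refine (compatible_iff (htube _ h₁).2 (htube _ h₂).2).mpr fun hc => ?_
    by_contra! hn
    have hlow : tubeWeight (u₁ ∪ u₂) ≤ ∑ v ∈ u₁ ∪ u₂, x v := by
      by_cases h : u₁ ∪ u₂ = Finset.univ
      · rw [h]; exact hx.1.ge
      · exact hx.2 _ ⟨h, by rwa [Finset.coe_union]⟩
    have hcard₁ : u₁.card < (u₁ ∪ u₂).card := Finset.card_lt_card
      ⟨Finset.subset_union_left, fun h => hn.2 (Finset.subset_union_right.trans h)⟩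
    have hcard₂ : u₂.card < (u₁ ∪ u₂).card := Finset.card_lt_card
      ⟨Finset.subset_union_right, fun h => hn.1 (Finset.subset_union_left.trans h)⟩
    have hpos := (nonempty_of_connected_induce (htube _ h₁).2).card_pos
    have hlt := sizeWeight_add_lt hcard₁ hcard₂ (by omega)
    have hsum := Finset.sum_union_inter (s₁ := u₁) (s₂ := u₂) (f := x)
    have hinter : 0 ≤ ∑ v ∈ u₁ ∩ u₂, x v :=
      Finset.sum_nonneg fun v _ => nonneg_of_mem_tubePolytope hx v
    have := sizeWeight_le_tubeWeight (u₁ ∪ u₂)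
    rw [sum_eq_of_mem_tightTubes h₁, sum_eq_of_mem_tightTubes h₂] at hsum
    linarith
  · intro hG hall
    obtain ⟨v⟩ := ‹Nonempty V›
    obtain ⟨u, hu, huC⟩ := hall (G.connectedComponentMk v)
    -- If all components were tight, the complement of one, being a union of others, would have sum
    -- at most its size weight, and the total would fall below the prescribed one.
    have hrest : ∑ y ∈ uᶜ, x y ≤ sizeWeight uᶜ.card := by
      refine sum_le_sizeWeight_of_cover
        (U := (tightTubes G x).filter fun s => ∃ C : G.ConnectedComponent, (s : Set V) = C.supp)
        (fun s hs r hr y hys hyr => ?_)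
        (fun s hs => sum_eq_of_mem_tightTubes (Finset.mem_filter.mp hs).1) _ fun y hy => ?_
      · obtain ⟨C, hC⟩ := (Finset.mem_filter.mp hs).2
        obtain ⟨D, hD⟩ := (Finset.mem_filter.mp hr).2
        rw [← Finset.mem_coe, hC] at hys
        rw [← Finset.mem_coe, hD] at hyr
        left
        rw [← Finset.coe_subset, hC, hD, ← show C = D from hys.symm.trans hyr]
      · obtain ⟨s, hs, hsC⟩ := hall (G.connectedComponentMk y)
        refine ⟨s, Finset.mem_filter.mpr ⟨hs, _, hsC⟩, ?_, fun z hz => ?_⟩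
        · rw [← Finset.mem_coe, hsC]; rfl
        · rw [Finset.mem_compl, ← Finset.mem_coe, huC] at hy ⊢
          rw [← Finset.mem_coe, hsC] at hz
          exact fun h => hy ((show _ = _ from hz).symm.trans h)
    have hcompl := Finset.card_add_card_compl u
    have hpos := (nonempty_of_connected_induce (htube _ hu).2).card_pos
    have hlt : u.card < Fintype.card V := (Finset.card_lt_iff_ne_univ u).mpr (htube u hu).1
    have h1 := sizeWeight_add_lt (a := u.card) (b := uᶜ.card) (k := Fintype.card V)
      hlt (by omega) (by omega)
    have h2 := Finset.sum_add_sum_compl u x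
    rw [sum_eq_of_mem_tightTubes hu, hx.1] at h2
    have h3 := sizeWeight_le_tubeWeight (Finset.univ : Finset V)
    rw [Finset.card_univ] at h3
    linarith

/-- A small move in a direction that does not violate the tight inequalities stays in the
polytope, and keeps tight exactly the inequalities whose value is unchanged. -/
theorem eventually_add_smul_mem {x d : V → ℝ} (hx : x ∈ tubePolytope G) (hd : ∑ v, d v = 0)
    (hT : ∀ u ∈ tightTubes G x, 0 ≤ ∑ v ∈ u, d v) :
    ∀ᶠ ε in 𝓝[>] (0 : ℝ), x + ε • d ∈ tubePolytope G ∧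
      ∀ u, u ∈ tightTubes G (x + ε • d) ↔ u ∈ tightTubes G x ∧ ∑ v ∈ u, d v = 0 := by
  have hslack : ∀ᶠ ε in 𝓝[>] (0 : ℝ), ∀ u, IsTube G u → u ∉ tightTubes G x →
      tubeWeight u < ∑ v ∈ u, (x + ε • d) v := by
    refine eventually_all.mpr fun u => ?_
    by_cases hu : IsTube G u ∧ u ∉ tightTubes G x
    · have hlt : tubeWeight u < ∑ v ∈ u, x v := lt_of_le_of_ne (hx.2 u hu.1) fun h =>
        hu.2 (mem_tightTubes.mpr ⟨hu.1, h.symm⟩)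
      have hcont : Continuous fun ε : ℝ => ∑ v ∈ u, x v + ε * ∑ v ∈ u, d v := by fun_prop
      have := (hcont.tendsto 0).eventually (lt_mem_nhds (a := tubeWeight u) (by simpa using hlt))
      filter_upwards [nhdsWithin_le_nhds this] with ε hε _ _
      rwa [sum_add_smul]
    · exact Eventually.of_forall fun ε h1 h2 => absurd ⟨h1, h2⟩ hu
  filter_upwards [hslack, self_mem_nhdsWithin] with ε hε hpos
  have hpos : 0 < ε := hpos
  refine ⟨⟨by rw [sum_add_smul, hd, mul_zero, add_zero, hx.1], fun u hu => ?_⟩, fun u => ?_⟩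
  · by_cases hut : u ∈ tightTubes G x
    · rw [sum_add_smul, (mem_tightTubes.mp hut).2]
      have := mul_nonneg hpos.le (hT u hut)
      linarith
    · exact (hε u hu hut).le
  · by_cases hut : u ∈ tightTubes G x
    · have h := mem_tightTubes.mp hut
      rw [mem_tightTubes, sum_add_smul, h.2]
      simp [hut, h.1, hpos.ne']
    · simp only [hut, false_and, iff_false, mem_tightTubes, not_and]
      exact fun hu => (hε u hu hut).ne'

variable (G) in
/-- The part of the polytope on which all inequalities from `U` are attained. -/
def tubeFace (U : Finset (Finset V)) : Set (V → ℝ) :=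
  {x ∈ tubePolytope G | U ⊆ tightTubes G x}

/-- Start at c(W) for a maximal `W ⊇ U` and move so that exactly the sums over the tubes of `W \ U`
increase. -/
theorem exists_tightTubes_eq [Nonempty V] {U : Finset (Finset V)} (hU : IsTubing G U) :
    ∃ x ∈ tubePolytope G, tightTubes G x = U := by
  classical
  obtain ⟨W, hUW, hW, hcard⟩ := hU.exists_maxTubing
  obtain ⟨c, hc, -⟩ := hW.existsUnique_sum_eq hcard tubeWeight
  obtain ⟨d, hd, -⟩ := hW.existsUnique_sum_eq hcard fun s => if s ∈ W \ U then 1 else 0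
  have hT := hW.tightTubes_eq hcard hc
  have hd0 : ∑ v, d v = 0 := by
    rw [hd _ (.inr rfl), if_neg]
    exact fun h => hW.univ_notMem (Finset.mem_sdiff.mp h).1
  obtain ⟨ε, h1, h2⟩ := (eventually_add_smul_mem (hW.mem_tubePolytope hcard hc) hd0
    (fun u hu => by
      rw [hd u (.inl (hT ▸ hu))]
      split_ifs <;> norm_num)).exists
  refine ⟨_, h1, ?_⟩
  ext u
  rw [h2, hT]
  refine ⟨fun ⟨hu, h⟩ => ?_, fun hu => ⟨hUW hu, ?_⟩⟩
  · rw [hd u (.inl hu)] at h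
    by_contra hn
    simp [hu, hn] at h
  · rw [hd u (.inl (hUW hu))]
    simp [hu]

theorem tubeFace_nonempty [Nonempty V] {U : Finset (Finset V)} (hU : IsTubing G U) :
    (tubeFace G U).Nonempty := by
  obtain ⟨x, hx, h⟩ := exists_tightTubes_eq hU
  exact ⟨x, hx, h.ge⟩

theorem tubeFace_subset_iff [Nonempty V] {U U' : Finset (Finset V)} (hU : IsTubing G U) :
    tubeFace G U ⊆ tubeFace G U' ↔ U' ⊆ U := by
  refine ⟨fun h => ?_, fun h x hx => ⟨hx.1, h.trans hx.2⟩⟩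
  obtain ⟨x, hx, hT⟩ := exists_tightTubes_eq hU
  exact hT ▸ (h ⟨hx, hT.ge⟩).2

theorem tubeFace_empty : tubeFace G ∅ = tubePolytope G := by
  simp [tubeFace]

theorem isExposed_tubeFace [Nonempty V] {U : Finset (Finset V)} (hU : IsTubing G U) :
    IsExposed ℝ (tubePolytope G) (tubeFace G U) := by
  rintro ⟨x₀, hx₀⟩
  -- The sign is negative because exposed faces maximize. Each tube sum is bounded below separately,
  -- so the bound on the total is attained only when every tube of `U` is tight.
  let l : StrongDual ℝ (V → ℝ) := -∑ u ∈ U, ∑ v ∈ u, ContinuousLinearMap.proj v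
  have hl : ∀ x, l x = -∑ u ∈ U, ∑ v ∈ u, x v := fun x => by simp [l]
  have hle : ∀ y ∈ tubePolytope G, ∑ u ∈ U, tubeWeight u ≤ ∑ u ∈ U, ∑ v ∈ u, y v := fun y hy =>
    Finset.sum_le_sum fun u hu => hy.2 u (hU.isTube u hu)
  have heq : ∀ x ∈ tubeFace G U, ∑ u ∈ U, ∑ v ∈ u, x v = ∑ u ∈ U, tubeWeight u := fun x hx =>
    Finset.sum_congr rfl fun u hu => (mem_tightTubes.mp (hx.2 hu)).2
  refine ⟨l, Set.ext fun x => ⟨fun hx => ⟨hx.1, fun y hy => ?_⟩, fun ⟨hx, hmax⟩ => ⟨hx, ?_⟩⟩⟩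
  · rw [hl, hl, heq x hx]
    linarith [hle y hy]
  · have h := hmax x₀ hx₀.1
    rw [hl, hl, heq x₀ hx₀] at h
    have h' := (Finset.sum_eq_sum_iff_of_le fun u hu => hx.2 u (hU.isTube u hu)).mp
      (le_antisymm (hle x hx) (by linarith))
    exact fun u hu => mem_tightTubes.mpr ⟨hU.isTube u hu, (h' u hu).symm⟩

theorem convex_tubePolytope : Convex ℝ (tubePolytope G) := by
  intro x hx y hy a b ha hb hab
  have hsum : ∀ u : Finset V, ∑ v ∈ u, (a • x + b • y) v
      = a * ∑ v ∈ u, x v + b * ∑ v ∈ u, y v := fun u => by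
    simp [Finset.sum_add_distrib, Finset.mul_sum]
  refine ⟨?_, fun u hu => ?_⟩
  · rw [hsum, hx.1, hy.1, ← add_mul, hab, one_mul]
  · rw [hsum]
    calc tubeWeight u = a * tubeWeight u + b * tubeWeight u := by rw [← add_mul, hab, one_mul]
      _ ≤ _ := add_le_add (mul_le_mul_of_nonneg_left (hx.2 u hu) ha)
        (mul_le_mul_of_nonneg_left (hy.2 u hu) hb)

theorem mem_tightTubes_of_mem_midpoint {x y : V → ℝ} (hx : x ∈ tubePolytope G)
    (hy : y ∈ tubePolytope G) {u : Finset V}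
    (hu : u ∈ tightTubes G ((1 / 2 : ℝ) • x + (1 / 2 : ℝ) • y)) :
    u ∈ tightTubes G x ∧ u ∈ tightTubes G y := by
  obtain ⟨hu, h⟩ := mem_tightTubes.mp hu
  have hsum : ∑ v ∈ u, ((1 / 2 : ℝ) • x + (1 / 2 : ℝ) • y) v
      = 1 / 2 * ∑ v ∈ u, x v + 1 / 2 * ∑ v ∈ u, y v := by
    simp [Finset.sum_add_distrib, Finset.mul_sum]
  have h1 := hx.2 u hu
  have h2 := hy.2 u hu
  exact ⟨mem_tightTubes.mpr ⟨hu, by linarith⟩, mem_tightTubes.mpr ⟨hu, by linarith⟩⟩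

/-- Every nonempty exposed face is cut out by a tubing. -/
theorem exists_eq_tubeFace [Nonempty V] {F : Set (V → ℝ)} (hne : F.Nonempty)
    (hF : IsExposed ℝ (tubePolytope G) F) : ∃ U, IsTubing G U ∧ F = tubeFace G U := by
  obtain ⟨l, rfl⟩ := hF hne
  -- A point of the face with fewest tight tubes plays the role of a relative interior point. Its
  -- midpoint with any `y` in the face has no fewer, so `y` shares all its tight tubes.
  obtain ⟨x, hxF, hmin⟩ : ∃ x ∈ {x ∈ tubePolytope G | ∀ y ∈ tubePolytope G, l y ≤ l x},
      ∀ y ∈ {x ∈ tubePolytope G | ∀ y ∈ tubePolytope G, l y ≤ l x},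
      (tightTubes G x).card ≤ (tightTubes G y).card := by
    obtain ⟨x, hx, h⟩ := WellFounded.has_min
      (measure fun x : V → ℝ => (tightTubes G x).card).wf _ hne
    exact ⟨x, hx, fun y hy => not_lt.mp (h y hy)⟩
  refine ⟨_, isTubing_tightTubes hxF.1, Set.Subset.antisymm (fun y hy => ⟨hy.1, ?_⟩) ?_⟩
  · have hz : (1 / 2 : ℝ) • x + (1 / 2 : ℝ) • y ∈ tubePolytope G :=
      convex_tubePolytope hxF.1 hy.1 (by norm_num) (by norm_num) (by norm_num)
    have hcard := hmin _ ⟨hz, fun w hw => by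
      simp only [map_add, map_smul, smul_eq_mul]
      linarith [hxF.2 w hw, hy.2 w hw]⟩
    have heq := Finset.eq_of_subset_of_card_le
      (fun u hu => (mem_tightTubes_of_mem_midpoint hxF.1 hy.1 hu).1) hcard
    exact fun u hu => (mem_tightTubes_of_mem_midpoint hxF.1 hy.1 (heq ▸ hu)).2
  · intro y hy
    -- The segment from `y` to `x` can be prolonged slightly beyond `x` inside the polytope;
    -- maximality of `l` at `x` then excludes `l y < l x`.
    have hzero : ∀ u ∈ tightTubes G x, ∑ v ∈ u, (x - y) v = 0 := fun u hu => by
      simp [(mem_tightTubes.mp hu).2, (mem_tightTubes.mp (hy.2 hu)).2]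
    obtain ⟨ε, ⟨h1, -⟩, hε⟩ := ((eventually_add_smul_mem (d := x - y) hxF.1
      (by simp [hxF.1.1, hy.1.1]) (fun u hu => (hzero u hu).ge)).and self_mem_nhdsWithin).exists
    have hε : 0 < ε := hε
    have h := hxF.2 _ h1
    rw [map_add, map_smul, map_sub, smul_eq_mul] at h
    have hxy : l x ≤ l y := by
      by_contra! hlt
      have := mul_pos hε (sub_pos.mpr hlt)
      linarith
    exact ⟨hy.1, fun z hz => (hxF.2 z hz).trans hxy⟩

theorem isCompact_tubePolytope : IsCompact (tubePolytope G) := by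
  refine Metric.isCompact_of_isClosed_isBounded ?_ ?_
  · have : tubePolytope G = {x : V → ℝ | ∑ v, x v = tubeWeight (Finset.univ : Finset V)} ∩
        ⋂ u : Finset V, ⋂ _ : IsTube G u, {x : V → ℝ | tubeWeight u ≤ ∑ v ∈ u, x v} := by
      ext x; simp [tubePolytope]
    rw [this]
    refine (isClosed_eq (by fun_prop) continuous_const).inter ?_
    exact isClosed_iInter fun u => isClosed_iInter fun _ =>
      isClosed_le continuous_const (by fun_prop)
  · refine (Metric.isBounded_Icc (0 : V → ℝ)
      fun _ => tubeWeight (Finset.univ : Finset V)).subset fun x hx => ⟨?_, ?_⟩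
    · exact nonneg_of_mem_tubePolytope hx
    · intro v
      have := Finset.single_le_sum (fun y _ => nonneg_of_mem_tubePolytope hx y)
        (Finset.mem_univ v)
      rwa [hx.1] at this

variable [Nonempty V]

/-- If the tight tubing were not maximal, some direction would change the sum over a missing
compatible tube and keep all tight sums, making the point the midpoint of a segment in the polytope.
-/
theorem card_tightTubes_of_mem_extremePoints {x : V → ℝ}
    (hx : x ∈ (tubePolytope G).extremePoints ℝ) :
    (tightTubes G x).card + 1 = Fintype.card V := by
  classical
  have hU := isTubing_tightTubes hx.1
  obtain ⟨W, hUW, hW, hcard⟩ := hU.exists_maxTubing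
  by_cases hWU : W ⊆ tightTubes G x
  · rw [hUW.antisymm hWU, hcard]
  exfalso
  obtain ⟨s, hsW, hsU⟩ := Finset.not_subset.mp hWU
  obtain ⟨d, hd, -⟩ := hW.existsUnique_sum_eq hcard fun r => if r = s then 1 else 0
  have hd0 : ∑ v, d v = 0 := by
    rw [hd _ (.inr rfl), if_neg]
    rintro rfl
    exact hW.univ_notMem hsW
  have hdU : ∀ u ∈ tightTubes G x, ∑ v ∈ u, d v = 0 := by
    intro u hu
    rw [hd u (.inl (hUW hu)), if_neg]
    rintro rfl
    exact hsU hu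
  obtain ⟨ε, ⟨⟨h1, -⟩, h2, -⟩, hε⟩ := (((eventually_add_smul_mem hx.1 hd0
    (fun u hu => (hdU u hu).ge)).and (eventually_add_smul_mem (d := -d) hx.1 (by simp [hd0])
    (fun u hu => by simp [hdU u hu]))).and self_mem_nhdsWithin).exists
  have hε : 0 < ε := hε
  have hseg : x ∈ openSegment ℝ (x + ε • d) (x + ε • -d) := by
    refine ⟨1 / 2, 1 / 2, by norm_num, by norm_num, by norm_num, ?_⟩
    ext v
    simp
    ring
  have hxd := hx.2 h1 h2 hseg
  obtain rfl : d = 0 := by simpa [hε.ne'] using hxd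
  simpa using hd s (.inl hsW)

theorem convexHull_eq_tubePolytope {c : MaxTubing G → V → ℝ}
    (hc : ∀ U : MaxTubing G, ∀ s, s ∈ U.1 ∨ s = Finset.univ → ∑ x ∈ s, c U x = tubeWeight s) :
    convexHull ℝ (Set.range c) = tubePolytope G := by
  refine Set.Subset.antisymm (convexHull_min ?_ convex_tubePolytope) ?_
  · rintro _ ⟨U, rfl⟩
    exact U.2.1.mem_tubePolytope U.2.2 (hc U)
  -- Krein–Milman: each extreme point solves the equations of its own maximal tubing, hence is a
  -- c(U).
  · rw [← closure_convexHull_extremePoints isCompact_tubePolytope convex_tubePolytope]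
    refine closure_minimal (convexHull_mono fun x hx => ?_)
      ((Set.finite_range c).isClosed_convexHull ℝ)
    have hU := isTubing_tightTubes hx.1
    have hcard := card_tightTubes_of_mem_extremePoints hx
    refine ⟨⟨tightTubes G x, hU, hcard⟩, ?_⟩
    refine (hU.existsUnique_sum_eq hcard tubeWeight).unique (hc ⟨_, hU, hcard⟩) fun s hs => ?_
    rcases hs with hs | rfl
    · exact (mem_tightTubes.mp hs).2
    · exact hx.1.1

/-- The direction space is the kernel of the |U|+1 sum functionals, which are independent because
`U` extends to a maximal tubing. -/
theorem dim_tubeFace {U : Finset (Finset V)} (hU : IsTubing G U) :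
    dim (tubeFace G U) + U.card + 1 = Fintype.card V := by
  classical
  let L : (V → ℝ) →ₗ[ℝ] (↥(insert Finset.univ U) → ℝ) :=
    LinearMap.pi fun s => ∑ x ∈ s.1, LinearMap.proj x
  have hL : ∀ f s, L f s = ∑ x ∈ s.1, f x := fun f s => by simp [L]
  have hsurj : Function.Surjective L := by
    intro b
    obtain ⟨W, hUW, hW, hcard⟩ := hU.exists_maxTubing
    obtain ⟨f, hf, -⟩ := hW.existsUnique_sum_eq hcard
      fun s => if h : s ∈ insert Finset.univ U then b ⟨s, h⟩ else 0
    refine ⟨f, funext fun s => ?_⟩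
    rw [hL, hf s.1 ((Finset.mem_insert.mp s.2).symm.imp_left fun h => hUW h), dif_pos s.2]
  have hker : ∀ d, d ∈ LinearMap.ker L ↔
      ∑ v, d v = 0 ∧ ∀ u ∈ U, ∑ v ∈ u, d v = 0 := by
    intro d
    rw [LinearMap.mem_ker, funext_iff]
    simp [hL]
  have hspan : vectorSpan ℝ (tubeFace G U) = LinearMap.ker L := by
    apply le_antisymm
    · rw [vectorSpan_def, Submodule.span_le]
      rintro _ ⟨x, hx, y, hy, rfl⟩
      rw [SetLike.mem_coe, hker]
      refine ⟨by simp [hx.1.1, hy.1.1], fun u hu => ?_⟩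
      simp [(mem_tightTubes.mp (hx.2 hu)).2, (mem_tightTubes.mp (hy.2 hu)).2]
    · intro d hd
      rw [hker] at hd
      obtain ⟨x, hx, hT⟩ := exists_tightTubes_eq hU
      obtain ⟨ε, ⟨h1, h2⟩, hε⟩ := ((eventually_add_smul_mem hx hd.1
        (fun u hu => (hd.2 u (hT ▸ hu)).ge)).and self_mem_nhdsWithin).exists
      have hε : 0 < ε := hε
      have hmem : ε • d ∈ vectorSpan ℝ (tubeFace G U) := by
        have := vsub_mem_vectorSpan ℝ (s := tubeFace G U) (p₁ := x + ε • d) (p₂ := x)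
          ⟨h1, fun u hu => (h2 u).mpr ⟨hT ▸ hu, hd.2 u hu⟩⟩ ⟨hx, hT.ge⟩
        simpa using this
      simpa [smul_smul, hε.ne'] using Submodule.smul_mem _ ε⁻¹ hmem
  have hrank := LinearMap.finrank_range_add_finrank_ker L
  rw [LinearMap.range_eq_top.mpr hsurj, finrank_top, Module.finrank_fintype_fun_eq_card,
    Module.finrank_fintype_fun_eq_card, Fintype.card_coe,
    Finset.card_insert_of_notMem hU.univ_notMem] at hrank
  rw [dim, hspan]
  omega

variable (G) in
/-- Tubings, ordered by reverse inclusion, are the faces of the polytope. -/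
noncomputable def tubingOrderIsoFace : (Tubing G)ᵒᵈ ≃o Face (tubePolytope G) :=
  OrderIso.ofSurjective
    (OrderEmbedding.ofMapLEIff
      (fun U => ⟨tubeFace G (OrderDual.ofDual U).1,
        tubeFace_nonempty (OrderDual.ofDual U).2, isExposed_tubeFace (OrderDual.ofDual U).2⟩)
      fun U _ => tubeFace_subset_iff (OrderDual.ofDual U).2)
    fun F => by
      obtain ⟨U, hU, hF⟩ := exists_eq_tubeFace F.2.1 F.2.2
      exact ⟨OrderDual.toDual ⟨U, hU⟩, Subtype.ext hF.symm⟩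

theorem coe_tubingOrderIsoFace (U : Tubing G) :
    (tubingOrderIsoFace G (OrderDual.toDual U) : Set (V → ℝ)) = tubeFace G U.1 := rfl

/-- Facets correspond to single tubes, and those through the vertex to the tubes of its tubing `U`.
Dimension 0 at the vertex gives |U| = n-1, the dimension of the polytope. -/
theorem encard_facets {x : V → ℝ} (hx : IsExposed ℝ (tubePolytope G) {x}) :
    {F : Face (tubePolytope G) | IsFacet F ∧ x ∈ F.1}.encard = (dim (tubePolytope G) : ℕ∞) := by
  obtain ⟨U, hU, hxU⟩ := exists_eq_tubeFace (Set.singleton_nonempty x) hx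
  have hdimP := dim_tubeFace (isTubing_empty (G := G))
  rw [tubeFace_empty, Finset.card_empty] at hdimP
  have hdimx := dim_tubeFace hU
  have h0 : dim ({x} : Set (V → ℝ)) = 0 := by simp [dim]
  rw [← hxU, h0] at hdimx
  have hsub : ∀ u : U, IsTubing G {u.1} := fun u => hU.mono (by simp)
  let ψ : U → Face (tubePolytope G) := fun u =>
    tubingOrderIsoFace G (OrderDual.toDual ⟨{u.1}, hsub u⟩)
  have hψ : Function.Injective ψ := fun u u' h => by
    have := (tubingOrderIsoFace G).injective h
    exact Subtype.ext (Finset.singleton_injective (congrArg Subtype.val this))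
  have hrange : {F : Face (tubePolytope G) | IsFacet F ∧ x ∈ F.1} = Set.range ψ := by
    ext F
    constructor
    · rintro ⟨hF, hxF⟩
      obtain ⟨W, rfl⟩ := (tubingOrderIsoFace G).surjective F
      obtain ⟨⟨W, hW⟩, rfl⟩ := OrderDual.toDual.surjective W
      rw [IsFacet, coe_tubingOrderIsoFace] at hF
      have hdimW := dim_tubeFace hW
      obtain ⟨u, rfl⟩ := Finset.card_eq_one.mp (show W.card = 1 by dsimp only at hF; omega)
      rw [coe_tubingOrderIsoFace] at hxF
      have hsubU : {u} ⊆ U := (tubeFace_subset_iff hU).mp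
        (hxU ▸ Set.singleton_subset_iff.mpr hxF)
      exact ⟨⟨u, hsubU (Finset.mem_singleton_self u)⟩, rfl⟩
    · rintro ⟨u, rfl⟩
      refine ⟨?_, ?_⟩
      · have := dim_tubeFace (hsub u)
        rw [IsFacet, coe_tubingOrderIsoFace]
        rw [Finset.card_singleton] at this
        dsimp only
        omega
      · rw [coe_tubingOrderIsoFace]
        refine (tubeFace_subset_iff (U' := {u.1}) hU).mpr (by simp) ?_
        rw [← hxU]
        rfl
  rw [hrange, ← Set.image_univ, hψ.encard_image, Set.encard_univ, ENat.card_eq_coe_fintype_card,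
    Fintype.card_coe]
  congr 1
  omega

theorem isGraphAssociahedron_tubePolytope : IsGraphAssociahedron G (tubePolytope G) := by
  refine ⟨⟨?_, ?_, fun x hx => encard_facets hx⟩, ⟨(tubingOrderIsoFace G).symm⟩⟩
  · choose c hc _ using fun U : MaxTubing G => U.2.1.existsUnique_sum_eq U.2.2 tubeWeight
    exact ⟨Set.range c, Set.finite_range c, (convexHull_eq_tubePolytope hc).symm⟩
  · exact tubeFace_empty (G := G) ▸ tubeFace_nonempty isTubing_empty

end Realization

end GraphAssociahedron

theorem theorem1 {V : Type*} [Fintype V] [Nonempty V] (G : SimpleGraph V) :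
    ∃ c : GraphAssociahedron.MaxTubing G → (V → ℝ),
      (∀ (U : GraphAssociahedron.MaxTubing G) (f : V → ℝ),
        GraphAssociahedron.IsNodeValuation U.1 f ↔ f = c U) ∧
      (2 ≤ Fintype.card V → ∀ (U : GraphAssociahedron.MaxTubing G) (v : V),
        ∃ m : ℤ, c U v = (m : ℝ)) ∧
      GraphAssociahedron.IsGraphAssociahedron G (convexHull ℝ (Set.range c)) := by
  choose c hc huniq using fun U : GraphAssociahedron.MaxTubing G =>
    U.2.1.existsUnique_sum_eq U.2.2 GraphAssociahedron.tubeWeight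
  refine ⟨c, fun U f => ?_, fun hV U v => U.2.1.exists_int_of_sum U.2.2 hV (hc U) v, ?_⟩
  · rw [U.2.1.isNodeValuation_iff]
    exact ⟨huniq U f, fun h => h ▸ hc U⟩
  · rw [GraphAssociahedron.convexHull_eq_tubePolytope hc]
    exact GraphAssociahedron.isGraphAssociahedron_tubePolytope
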